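/- Let $d\ge 2$. **Notation.** For $u\in L^1(\mathbb R^d)$ put $\|Du\|(\mathbb R^d)=\sup\{\int u\,\operatorname{div} v : v\in C^1_c(\mathbb R^d;\mathbb R^d),\ |v|\le 1\}$. Let $BV([0,1]^d)$ be the space of (classes of) functions $u\in L^1(\mathbb R^d)$ that vanish a.e. outside $[0,1]^d$ and satisfy $\|Du\|(\mathbb R^d)<\infty$, with the norm $\|u\|_{BV}=\|u\|_1+\|Du\|(\mathbb R^d)$. Let $SCH([0,1]^d)$ be the closure in the dual space $BV([0,1]^d)^*$ (for the operator norm) of the set of functionals $T_g\colon u\mapsto\int_{[0,1]^d} g\,u$ with $g\in L^d([0,1]^d)$. A $BV$-subset of $[0,1]^d$ is a measurable set $B\subset[0,1]^d$ with $\|D\mathbf 1_B\|(\mathbb R^d)<\infty$; a strong charge is a function on the $BV$-subsets of $[0,1]^d$ of the form $B\mapsto\alpha(\mathbf 1_B)$ with $\alpha\in SCH([0,1]^d)$. Let $C_0([0,1]^d)$ be the set of continuous functions on $[0,1]^d$ that vanish at every point having at least one zero coordinate. For $f\in C_0([0,1]^d)$ and a rectangle $K=\prod_{i=1}^d[a_i,b_i]\subset[0,1]^d$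 with $a_i<b_i$, let $$\Delta_f(K)=\sum_{c\in\prod_i\{a_i,b_i\}}(-1)^{\#\{i\,:\,c_i=a_i\}}f(c),$$ and extend $\Delta_f$ by finite additivity to figures, i.e. to finite unions of rectangles: $\Delta_f(K_1\cup\dots\cup K_n)=\sum_j\Delta_f(K_j)$ for pairwise almost disjoint rectangles $K_1,\dots,K_n$. The function $f$ is called *strongly chargeable* if $\Delta_f$ extends from figures to a strong charge. **Theorem.** Let $W=(W_t)_{t\in[0,1]^d}$ be a standard Brownian sheet on a probability space, that is, a centered Gaussian process with covariance $\mathbb E(W_sW_t)=\prod_{i=1}^d\min(s_i,t_i)$, all of whose sample paths $t\mapsto W_t(\omega)$ belong to $C_0([0,1]^d)$. Then, almost surely, the sample path of $W$ is not strongly chargeable. -/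

import Mathlib

open MeasureTheory ProbabilityTheory
open scoped ENNReal

noncomputable section

namespace BrownianSheet

/-- `ℝ^d` with its Euclidean norm and Lebesgue measure. -/
abbrev Eucl (d : ℕ) : Type := EuclideanSpace ℝ (Fin d)

/-- The closed unit cube `[0,1]^d` as a subset of `ℝ^d`. -/
def cube (d : ℕ) : Set (Eucl d) := {x | ∀ i, 0 ≤ x i ∧ x i ≤ 1}

/-! ### Functions of bounded variation -/

/-- The divergence of a vector field, `∑ i, ∂ᵢ vᵢ`. -/
def diverg {d : ℕ} (v : Eucl d → Eucl d) (x : Eucl d) : ℝ :=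
  ∑ i, (fderiv ℝ v x (EuclideanSpace.single i 1)) i

/-- The vector fields in `C¹_c(ℝ^d; ℝ^d)` with `|v| ≤ 1` everywhere. -/
def testFields (d : ℕ) : Set (Eucl d → Eucl d) :=
  {v | ContDiff ℝ 1 v ∧ HasCompactSupport v ∧ ∀ x, ‖v x‖ ≤ 1}

/-- The variation `‖Du‖(ℝ^d) = sup {∫ u div v : v ∈ C¹_c(ℝ^d; ℝ^d), |v| ≤ 1} ∈ [0,∞]` of an integrable
function `u` on `ℝ^d`. (The supremum is nonnegative because `v = 0` is allowed.) -/
def variation {d : ℕ} (u : Eucl d → ℝ) : ℝ≥0∞ :=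
  ⨆ v ∈ testFields d, ENNReal.ofReal (∫ x, u x * diverg v x)

lemma continuous_diverg {d : ℕ} {v : Eucl d → Eucl d} (hv : v ∈ testFields d) :
    Continuous (diverg v) := by
  have h : Continuous (fderiv ℝ v) := hv.1.continuous_fderiv (by norm_num)
  unfold diverg
  fun_prop

lemma hasCompactSupport_diverg {d : ℕ} {v : Eucl d → Eucl d} (hv : v ∈ testFields d) :
    HasCompactSupport (diverg v) := by
  have h : HasCompactSupport (fderiv ℝ v) := hv.2.1.fderiv ℝ
  refine h.comp_left (g := fun L : Eucl d →L[ℝ] Eucl d =>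
    ∑ i, (L (EuclideanSpace.single i 1)) i) ?_
  simp

lemma integrable_mul_diverg {d : ℕ} {u : Eucl d → ℝ} (hu : Integrable u)
    {v : Eucl d → Eucl d} (hv : v ∈ testFields d) :
    Integrable (fun x => u x * diverg v x) := by
  obtain ⟨C, hC⟩ := (continuous_diverg hv).bounded_above_of_compact_support
    (hasCompactSupport_diverg hv)
  exact hu.mul_bdd (c := C) (continuous_diverg hv).aestronglyMeasurable (.of_forall hC)

lemma neg_mem_testFields {d : ℕ} {v : Eucl d → Eucl d} (hv : v ∈ testFields d) :
    -v ∈ testFields d :=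
  ⟨hv.1.neg, hv.2.1.neg, fun x => by simpa using hv.2.2 x⟩

lemma diverg_neg {d : ℕ} (v : Eucl d → Eucl d) (x : Eucl d) :
    diverg (-v) x = -diverg v x := by
  simp [diverg, fderiv_neg]

lemma variation_congr {d : ℕ} {u w : Eucl d → ℝ} (h : u =ᵐ[volume] w) :
    variation u = variation w := by
  unfold variation
  refine iSup_congr fun v => iSup_congr fun _ => ?_
  congr 1
  apply integral_congr_ae
  filter_upwards [h] with x hx
  rw [hx]

lemma variation_zero {d : ℕ} : variation (fun _ : Eucl d => (0 : ℝ)) = 0 := by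
  simp [variation]

lemma variation_add_le {d : ℕ} {u w : Eucl d → ℝ} (hu : Integrable u) (hw : Integrable w) :
    variation (fun x => u x + w x) ≤ variation u + variation w := by
  refine iSup₂_le fun v hv => ?_
  simp only [add_mul]
  rw [integral_add (integrable_mul_diverg hu hv) (integrable_mul_diverg hw hv)]
  refine ENNReal.ofReal_add_le.trans (add_le_add ?_ ?_)
  · exact le_iSup₂ (f := fun v (_ : v ∈ testFields d) =>
      ENNReal.ofReal (∫ x, u x * diverg v x)) v hv
  · exact le_iSup₂ (f := fun v (_ : v ∈ testFields d) =>
      ENNReal.ofReal (∫ x, w x * diverg v x)) v hv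

lemma variation_smul_le {d : ℕ} (c : ℝ) (u : Eucl d → ℝ) :
    variation (fun x => c * u x) ≤ ENNReal.ofReal |c| * variation u := by
  refine iSup₂_le fun v hv => ?_
  simp only [mul_assoc]
  rw [integral_const_mul]
  rcases le_total 0 c with hc | hc
  · rw [ENNReal.ofReal_mul hc, abs_of_nonneg hc]
    gcongr
    exact le_iSup₂ (f := fun v (_ : v ∈ testFields d) =>
      ENNReal.ofReal (∫ x, u x * diverg v x)) v hv
  · have h1 : c * ∫ x, u x * diverg v x = |c| * ∫ x, u x * diverg (-v) x := by
      simp only [diverg_neg, mul_neg, integral_neg, abs_of_nonpos hc]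
      ring
    rw [h1, ENNReal.ofReal_mul (abs_nonneg c)]
    gcongr
    exact le_iSup₂ (f := fun v (_ : v ∈ testFields d) =>
      ENNReal.ofReal (∫ x, u x * diverg v x)) (-v) (neg_mem_testFields hv)

/-- The linear space underlying `BV([0,1]^d)`: the classes `u ∈ L¹(ℝ^d)` that vanish almost
everywhere outside `[0,1]^d` and have `‖Du‖(ℝ^d) < ∞`. -/
def bvSubmodule (d : ℕ) : Submodule ℝ (Lp ℝ 1 (volume : Measure (Eucl d))) where
  carrier := {u | (∀ᵐ x, x ∉ cube d → u x = 0) ∧ variation u < ⊤}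
  zero_mem' := by
    have h : (⇑(0 : Lp ℝ 1 (volume : Measure (Eucl d)))) =ᵐ[volume] fun _ => (0 : ℝ) :=
      Lp.coeFn_zero ℝ 1 volume
    refine ⟨?_, ?_⟩
    · filter_upwards [h] with x hx _ using hx
    · rw [variation_congr h, variation_zero]
      exact ENNReal.zero_lt_top
  add_mem' := by
    intro u w hu hw
    have h : ⇑(u + w) =ᵐ[volume] fun x => u x + w x := Lp.coeFn_add u w
    refine ⟨?_, ?_⟩
    · filter_upwards [h, hu.1, hw.1] with x hx h1 h2 h3
      rw [hx, h1 h3, h2 h3, add_zero]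
    · rw [variation_congr h]
      exact (variation_add_le (L1.integrable_coeFn u) (L1.integrable_coeFn w)).trans_lt
        (ENNReal.add_lt_top.2 ⟨hu.2, hw.2⟩)
  smul_mem' := by
    intro c u hu
    have h : ⇑(c • u) =ᵐ[volume] fun x => c * u x := Lp.coeFn_smul c u
    refine ⟨?_, ?_⟩
    · filter_upwards [h, hu.1] with x hx h1 h3
      rw [hx, h1 h3, mul_zero]
    · rw [variation_congr h]
      exact (variation_smul_le c u).trans_lt (ENNReal.mul_lt_top ENNReal.ofReal_lt_top hu.2)

/-- The space `BV([0,1]^d)`. It is a type of its own (not a subspace of `L¹`), since it carries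
the `BV` norm and not the `L¹` norm. -/
def BV (d : ℕ) : Type := bvSubmodule d

namespace BV

variable {d : ℕ}

instance : AddCommGroup (BV d) := inferInstanceAs (AddCommGroup (bvSubmodule d))

instance : Module ℝ (BV d) := inferInstanceAs (Module ℝ (bvSubmodule d))

/-- The class in `L¹(ℝ^d)` of a function of bounded variation. -/
def toL1 (u : BV d) : Lp ℝ 1 (volume : Measure (Eucl d)) := Subtype.val u

lemma toL1_add (u w : BV d) : (u + w).toL1 = u.toL1 + w.toL1 := rfl

lemma toL1_smul (c : ℝ) (u : BV d) : (c • u).toL1 = c • u.toL1 := rfl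

lemma toL1_zero : (0 : BV d).toL1 = 0 := rfl

lemma toL1_injective : Function.Injective (toL1 : BV d → _) := Subtype.val_injective

lemma variation_lt_top (u : BV d) : variation u.toL1 < ⊤ := u.2.2

/-- The norm `‖u‖_BV = ‖u‖₁ + ‖Du‖(ℝ^d)`. -/
instance : Norm (BV d) := ⟨fun u => ‖u.toL1‖ + (variation u.toL1).toReal⟩

lemma norm_def (u : BV d) : ‖u‖ = ‖u.toL1‖ + (variation u.toL1).toReal := rfl

lemma variation_smul_toReal_le (c : ℝ) (u : BV d) :
    (variation (c • u).toL1).toReal ≤ |c| * (variation u.toL1).toReal := by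
  have h : ⇑(c • u).toL1 =ᵐ[volume] fun x => c * u.toL1 x := Lp.coeFn_smul c u.toL1
  rw [variation_congr h]
  have h2 := ENNReal.toReal_mono (ENNReal.mul_lt_top ENNReal.ofReal_lt_top
    (variation_lt_top u)).ne (variation_smul_le c u.toL1)
  rwa [ENNReal.toReal_mul, ENNReal.toReal_ofReal (abs_nonneg c)] at h2

lemma variation_smul_toReal (c : ℝ) (u : BV d) :
    (variation (c • u).toL1).toReal = |c| * (variation u.toL1).toReal := by
  refine le_antisymm (variation_smul_toReal_le c u) ?_
  rcases eq_or_ne c 0 with rfl | hc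
  · simp
  · have h := variation_smul_toReal_le c⁻¹ (c • u)
    rw [smul_smul, inv_mul_cancel₀ hc, one_smul, abs_inv] at h
    have hc' : 0 < |c| := abs_pos.2 hc
    calc |c| * (variation u.toL1).toReal
        ≤ |c| * (|c|⁻¹ * (variation (c • u).toL1).toReal) := by gcongr
      _ = (variation (c • u).toL1).toReal := by field_simp

lemma variation_add_toReal_le (u w : BV d) :
    (variation (u + w).toL1).toReal ≤ (variation u.toL1).toReal + (variation w.toL1).toReal := by
  have h : ⇑(u + w).toL1 =ᵐ[volume] fun x => u.toL1 x + w.toL1 x :=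
    Lp.coeFn_add u.toL1 w.toL1
  rw [variation_congr h, ← ENNReal.toReal_add (variation_lt_top u).ne (variation_lt_top w).ne]
  exact ENNReal.toReal_mono (ENNReal.add_lt_top.2 ⟨variation_lt_top u, variation_lt_top w⟩).ne
    (variation_add_le (L1.integrable_coeFn _) (L1.integrable_coeFn _))

lemma core : NormedSpace.Core ℝ (BV d) where
  norm_nonneg u := add_nonneg (norm_nonneg _) ENNReal.toReal_nonneg
  norm_smul c u := by
    rw [norm_def, norm_def, variation_smul_toReal, toL1_smul, norm_smul, Real.norm_eq_abs]
    ring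
  norm_triangle u w := by
    have h1 := norm_add_le u.toL1 w.toL1
    have h2 := variation_add_toReal_le u w
    rw [norm_def, norm_def, norm_def, toL1_add]
    rw [toL1_add] at h2
    linarith
  norm_eq_zero_iff u := by
    constructor
    · intro h
      have h1 : 0 ≤ (variation u.toL1).toReal := ENNReal.toReal_nonneg
      have h2 := norm_nonneg u.toL1
      rw [norm_def] at h
      have h3 : ‖u.toL1‖ = 0 := by linarith
      exact toL1_injective (norm_eq_zero.1 h3)
    · rintro rfl
      rw [norm_def, toL1_zero, variation_congr (Lp.coeFn_zero ℝ 1 volume)]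
      have h : variation (0 : Eucl d → ℝ) = 0 := variation_zero
      simp [h]

instance : NormedAddCommGroup (BV d) := NormedAddCommGroup.ofCore core

instance : NormedSpace ℝ (BV d) := NormedSpace.ofCore core

end BV

/-! ### Strong charge functionals -/

/-- The range of `T : L^d([0,1]^d) → BV([0,1]^d)^*`, `T_f(u) = ∫_{[0,1]^d} f u`.
(`f u` is integrable, and `T_f` is continuous, by the Sobolev inequality
`BV([0,1]^d) ⊆ L^{d/(d-1)}`; so each `f ∈ L^d([0,1]^d)` gives one element.) -/
def rangeT (d : ℕ) : Set (BV d →L[ℝ] ℝ) :=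
  {α | ∃ f : Eucl d → ℝ, MemLp f (d : ℝ≥0∞) (volume.restrict (cube d)) ∧
    ∀ u : BV d, α u = ∫ x in cube d, f x * u.toL1 x}

/-- The space `SCH([0,1]^d)` of strong charge functionals: the closure, for the operator norm, of
the range of `T` in `BV([0,1]^d)^*`. -/
def SCH (d : ℕ) : Set (BV d →L[ℝ] ℝ) := closure (rangeT d)

/-! ### `BV`-sets and strong charges -/

/-- The `BV`-subsets of `[0,1]^d`: the (Lebesgue) measurable subsets of finite perimeter
`‖B‖ = ‖D 1_B‖(ℝ^d)`. -/
structure BVSet (d : ℕ) where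
  carrier : Set (Eucl d)
  subset_cube : carrier ⊆ cube d
  measurable : NullMeasurableSet carrier volume
  perimeter_lt_top : variation (carrier.indicator fun _ => (1 : ℝ)) < ⊤

lemma volume_cube_lt_top (d : ℕ) : volume (cube d) < ⊤ := by
  refine (Metric.isBounded_iff_subset_closedBall (0 : Eucl d)).2 ⟨√d, fun x hx => ?_⟩
    |>.measure_lt_top
  rw [mem_closedBall_zero_iff, EuclideanSpace.norm_eq]
  refine Real.sqrt_le_sqrt ?_
  calc ∑ i, ‖x i‖ ^ 2 ≤ ∑ _i : Fin d, (1 : ℝ) := by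
        refine Finset.sum_le_sum fun i _ => ?_
        rw [Real.norm_eq_abs, sq_abs]
        nlinarith [(hx i).1, (hx i).2]
    _ = d := by simp

namespace BVSet

variable {d : ℕ}

lemma integrable_indicator (B : BVSet d) :
    Integrable (B.carrier.indicator fun _ => (1 : ℝ)) (volume : Measure (Eucl d)) := by
  refine IntegrableOn.integrable_indicator₀ ?_ B.measurable
  exact integrableOn_const
    (((measure_mono B.subset_cube).trans_lt (volume_cube_lt_top d)).ne) (by simp)

/-- The indicator function `1_B` as an element of `BV([0,1]^d)`. -/
def ind (B : BVSet d) : BV d :=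
  ⟨B.integrable_indicator.toL1 _, by
    have h := B.integrable_indicator.coeFn_toL1
    refine ⟨?_, ?_⟩
    · filter_upwards [h] with x hx hxc
      rw [hx]
      exact Set.indicator_of_notMem (fun hB => hxc (B.subset_cube hB)) _
    · rw [variation_congr h]
      exact B.perimeter_lt_top⟩

end BVSet

/-- A strong charge: a function on the `BV`-subsets of `[0,1]^d` of the form `B ↦ α(1_B)` with
`α ∈ SCH([0,1]^d)`. (Such a function is finitely additive and continuous with respect to
`BV`-convergence, i.e. it is a charge.) -/
def IsStrongCharge {d : ℕ} (μ : BVSet d → ℝ) : Prop :=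
  ∃ α ∈ SCH d, ∀ B : BVSet d, μ B = α B.ind

/-! ### Increments and strong chargeability -/

/-- `C₀([0,1]^d)`: the continuous functions on `[0,1]^d` that vanish at the points having at least
one zero coordinate. -/
def C0 (d : ℕ) : Type :=
  {f : C(Fin d → unitInterval, ℝ) // ∀ x : Fin d → unitInterval, (∃ i, x i = 0) → f x = 0}

instance {d : ℕ} : CoeFun (C0 d) (fun _ => (Fin d → unitInterval) → ℝ) := ⟨fun f => f.1⟩

/-- A rectangle `∏ [a_i, b_i] ⊆ [0,1]^d` with nonempty interior. -/
structure Rect (d : ℕ) where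
  a : Fin d → unitInterval
  b : Fin d → unitInterval
  lt : ∀ i, a i < b i

/-- The rectangle as a subset of `ℝ^d`. -/
def Rect.toSet {d : ℕ} (K : Rect d) : Set (Eucl d) :=
  {x | ∀ i, (K.a i : ℝ) ≤ x i ∧ x i ≤ (K.b i : ℝ)}

/-- The increment `Δ_f(K)`: the sum over the vertices `c ∈ ∏ {a_i, b_i}` of
`(-1)^{#{i : c_i = a_i}} f(c)`. The vertices are indexed by the set `s = {i : c_i = a_i}`. -/
def increment {d : ℕ} (f : C0 d) (K : Rect d) : ℝ :=
  ∑ s : Finset (Fin d), (-1 : ℝ) ^ s.card * f (fun i => if i ∈ s then K.a i else K.b i)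

/-- `μ` extends `Δ_f`, where `Δ_f` is extended from rectangles to figures by finite additivity: if a
figure `F` is the union of finitely many pairwise almost disjoint rectangles `K_1, …, K_n`, then
`Δ_f(F) = ∑ Δ_f(K_j)`. (Every figure is such a union, and is a `BV`-set.) -/
def ExtendsIncrement {d : ℕ} (f : C0 d) (μ : BVSet d → ℝ) : Prop :=
  ∀ (n : ℕ) (K : Fin n → Rect d),
    (∀ i j, i ≠ j → volume ((K i).toSet ∩ (K j).toSet) = 0) →
    ∀ F : BVSet d, F.carrier = ⋃ j, (K j).toSet → μ F = ∑ j, increment f (K j)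

/-- `f ∈ C₀([0,1]^d)` is strongly chargeable if `Δ_f` extends to a strong charge. -/
def StronglyChargeable {d : ℕ} (f : C0 d) : Prop :=
  ∃ μ : BVSet d → ℝ, IsStrongCharge μ ∧ ExtendsIncrement f μ

/-! ### The Brownian sheet -/

/-- `W` is a (standard) Brownian sheet on `[0,1]^d` with sample paths in `C₀([0,1]^d)`: a centered
Gaussian process with covariance `E(W_s W_t) = ∏ min(s_i, t_i)`. -/
structure IsBrownianSheet {Ω : Type*} [MeasurableSpace Ω] {d : ℕ} (W : Ω → C0 d)
    (P : Measure Ω) : Prop where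
  isGaussianProcess : IsGaussianProcess (fun (t : Fin d → unitInterval) (ω : Ω) => W ω t) P
  centered : ∀ t : Fin d → unitInterval, ∫ ω, W ω t ∂P = 0
  covariance : ∀ s t : Fin d → unitInterval,
    ∫ ω, W ω s * W ω t ∂P = ∏ i, min (s i : ℝ) (t i : ℝ)

end BrownianSheet

end

noncomputable section

namespace BrownianSheet

/-! ### Rectangles have finite perimeter -/

section Rectangles

variable {d : ℕ}

/-! Split the cube into `N ^ d` cells of side `1 / N` and let `S_N` be the sum of the absolute
increments over the cells. If `f` is strongly chargeable, `S_N = o(N)`: the functional lies within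
any `ε` of some `T_g`. The `T_g` parts contribute at most `∫ |g|` in total, and the error on a cell
is at most `ε` times its `BV` norm. That norm is dominated by the perimeter, of order `N ^ (1 - d)`,
so the errors add up to `O(ε N)` (`StronglyChargeable.sum_abs_increment_le`). For the sheet, the
cell increments are independent centered Gaussians of variance `N ^ (-d)`, so `S_N` has mean a
constant times `N ^ (d / 2)`, which is at least that constant times `N` because `d ≥ 2`, and
variance at most `1`. Chebyshev and Borel–Cantelli then keep `S_N` almost surely above a constant
times `N` eventually (`IsBrownianSheet.eventually_le_sum_abs_increment`). -/

lemma Rect.toSet_eq_preimage (K : Rect d) :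
    K.toSet = WithLp.ofLp ⁻¹' Set.Icc (fun i => (K.a i : ℝ)) (fun i => (K.b i : ℝ)) := by
  ext x
  simp [Rect.toSet, Set.mem_Icc, Pi.le_def, forall_and]

lemma Rect.measurableSet_toSet (K : Rect d) : MeasurableSet K.toSet := by
  rw [K.toSet_eq_preimage]
  exact (PiLp.volume_preserving_ofLp (Fin d)).measurable measurableSet_Icc

lemma Rect.toSet_subset_cube (K : Rect d) : K.toSet ⊆ cube d := fun _ hx i =>
  ⟨(K.a i).2.1.trans (hx i).1, (hx i).2.trans (K.b i).2.2⟩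

lemma Rect.volume_toSet (K : Rect d) :
    volume K.toSet = ∏ i, ENNReal.ofReal ((K.b i : ℝ) - K.a i) := by
  rw [K.toSet_eq_preimage, (PiLp.volume_preserving_ofLp (Fin d)).measure_preimage
    measurableSet_Icc.nullMeasurableSet, Real.volume_Icc_pi]

lemma abs_apply_le_norm (x : Eucl d) (i : Fin d) : |x i| ≤ ‖x‖ := by
  simpa using PiLp.norm_apply_le x i

/-- The integral of the divergence of a test field over a rectangle is at most the area of the
boundary of the rectangle. -/
lemma Rect.integral_diverg_le {n : ℕ} (K : Rect (n + 1)) {h : ℝ}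
    (hK : ∀ i, (K.b i : ℝ) - K.a i ≤ h) {v : Eucl (n + 1) → Eucl (n + 1)}
    (hv : v ∈ testFields (n + 1)) :
    ∫ x in K.toSet, diverg v x ≤ 2 * (n + 1) * h ^ n := by
  set a : Fin (n + 1) → ℝ := fun i => (K.a i : ℝ)
  set b : Fin (n + 1) → ℝ := fun i => (K.b i : ℝ)
  have hab : a ≤ b := fun i => (K.lt i).le
  let e := PiLp.continuousLinearEquiv 2 ℝ (fun _ : Fin (n + 1) => ℝ)
  have hmp := PiLp.volume_preserving_toLp (Fin (n + 1))
  have hemb : MeasurableEmbedding (@WithLp.toLp 2 (Fin (n + 1) → ℝ)) :=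
    (MeasurableEquiv.toLp 2 _).measurableEmbedding
  have hset : (@WithLp.toLp 2 (Fin (n + 1) → ℝ)) ⁻¹' K.toSet = Set.Icc a b := by
    rw [K.toSet_eq_preimage]; rfl
  rw [← hmp.setIntegral_preimage_emb hemb, hset]
  have hdiff : ∀ x, DifferentiableAt ℝ v x := hv.1.differentiable (by norm_num)
  have hcv : Continuous v := hv.1.continuous
  have htoLp : Continuous (@WithLp.toLp 2 (Fin (n + 1) → ℝ)) := e.symm.continuous
  -- The divergence theorem is applied in product coordinates, with the field conjugated by the
  -- identification `e`.
  have key := integral_divergence_of_hasFDerivAt_off_countable a b hab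
    (fun y => e (v (e.symm y)))
    (fun y => (e : Eucl (n + 1) →L[ℝ] (Fin (n + 1) → ℝ)) ∘L (fderiv ℝ v (e.symm y)) ∘L
      (e.symm : (Fin (n + 1) → ℝ) →L[ℝ] Eucl (n + 1))) ∅ Set.countable_empty
    (by fun_prop)
    (fun y _ => (e.hasFDerivAt.comp _ ((hdiff _).hasFDerivAt.comp y e.symm.hasFDerivAt)))
    (((continuous_diverg hv).comp htoLp).integrableOn_Icc)
  -- Each of the `2 * (n + 1)` faces has area at most `h ^ n`, and each component of a test field is
  -- bounded by `1`.
  have hface : ∀ (i : Fin (n + 1)) (g : (Fin n → ℝ) → ℝ), (∀ y, |g y| ≤ 1) →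
      |∫ y in Set.Icc (a ∘ i.succAbove) (b ∘ i.succAbove), g y| ≤ h ^ n := by
    intro i g hg
    have h1 := norm_setIntegral_le_of_norm_le_const (μ := volume)
      (s := Set.Icc (a ∘ i.succAbove) (b ∘ i.succAbove)) (f := g) (C := 1)
      (isCompact_Icc.measure_lt_top) (fun y _ => hg y)
    rw [one_mul, Measure.real,
      Real.volume_Icc_pi_toReal (show a ∘ i.succAbove ≤ b ∘ i.succAbove from fun j => hab _)] at h1
    refine h1.trans ?_
    calc ∏ j : Fin n, ((b ∘ i.succAbove) j - (a ∘ i.succAbove) j) ≤ ∏ _j : Fin n, h :=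
          Finset.prod_le_prod (fun j _ => sub_nonneg.2 (hab _)) (fun j _ => hK _)
      _ = h ^ n := by simp
  have hle : ∀ (i : Fin (n + 1)) (y : Fin (n + 1) → ℝ), |e (v (e.symm y)) i| ≤ 1 := fun i y =>
    (abs_apply_le_norm _ i).trans (hv.2.2 _)
  calc ∫ y in Set.Icc a b, diverg v (WithLp.toLp 2 y)
      = _ := key
    _ ≤ ∑ _i : Fin (n + 1), 2 * h ^ n := by
        refine Finset.sum_le_sum fun i _ => ?_
        have h1 := hface i (fun y => e (v (e.symm (i.insertNth (b i) y))) i) (fun y => hle i _)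
        have h2 := hface i (fun y => e (v (e.symm (i.insertNth (a i) y))) i) (fun y => hle i _)
        rw [abs_le] at h1 h2
        linarith
    _ = 2 * (n + 1) * h ^ n := by simp; ring

lemma Rect.variation_indicator_le {n : ℕ} (K : Rect (n + 1)) {h : ℝ}
    (hK : ∀ i, (K.b i : ℝ) - K.a i ≤ h) :
    variation (K.toSet.indicator fun _ => (1 : ℝ)) ≤ ENNReal.ofReal (2 * (n + 1) * h ^ n) := by
  refine iSup₂_le fun v hv => ENNReal.ofReal_le_ofReal ?_
  refine le_of_eq_of_le ?_ (K.integral_diverg_le hK hv)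
  rw [← integral_indicator K.measurableSet_toSet]
  congr with x
  by_cases hx : x ∈ K.toSet <;> simp [hx]

/-- A rectangle as a `BV`-set. -/
def Rect.toBVSet {n : ℕ} (K : Rect (n + 1)) : BVSet (n + 1) where
  carrier := K.toSet
  subset_cube := K.toSet_subset_cube
  measurable := K.measurableSet_toSet.nullMeasurableSet
  perimeter_lt_top := (K.variation_indicator_le (h := 1) fun i => by
    linarith [(K.a i).2.1, (K.b i).2.2]).trans_lt ENNReal.ofReal_lt_top

lemma BVSet.coeFn_ind (B : BVSet d) :
    ⇑B.ind.toL1 =ᵐ[volume] B.carrier.indicator fun _ => (1 : ℝ) :=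
  B.integrable_indicator.coeFn_toL1

/-- Volume plus perimeter. For small `h` the perimeter term dominates; it is the source of the
factor `N` in the grid estimate. -/
lemma Rect.norm_ind_le {n : ℕ} (K : Rect (n + 1)) {h : ℝ}
    (hK : ∀ i, (K.b i : ℝ) - K.a i ≤ h) :
    ‖K.toBVSet.ind‖ ≤ h ^ (n + 1) + 2 * (n + 1) * h ^ n := by
  have h0 : 0 ≤ h := (sub_nonneg.2 (show (K.a 0 : ℝ) ≤ K.b 0 from (K.lt 0).le)).trans (hK 0)
  rw [BV.norm_def]
  refine add_le_add ?_ ?_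
  · have h2 : (fun x => ‖K.toBVSet.ind.toL1 x‖) =ᵐ[volume]
        fun x => ‖K.toSet.indicator (fun _ => (1 : ℝ)) x‖ := K.toBVSet.coeFn_ind.fun_comp norm
    rw [L1.norm_eq_integral_norm, integral_congr_ae h2]
    have h1 : (fun x => ‖K.toSet.indicator (fun _ => (1 : ℝ)) x‖) =
        K.toSet.indicator fun _ => (1 : ℝ) := by
      ext x
      by_cases hx : x ∈ K.toSet <;> simp [hx]
    calc ∫ x, ‖K.toSet.indicator (fun _ => (1 : ℝ)) x‖ = volume.real K.toSet := by
          rw [h1, integral_indicator K.measurableSet_toSet]; simp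
      _ = ∏ i, ((K.b i : ℝ) - K.a i) := by
          rw [Measure.real, K.volume_toSet, ENNReal.toReal_prod]
          exact Finset.prod_congr rfl fun i _ =>
            ENNReal.toReal_ofReal (sub_nonneg.2 (K.lt i).le)
      _ ≤ ∏ _i : Fin (n + 1), h :=
          Finset.prod_le_prod (fun i _ => sub_nonneg.2 (K.lt i).le) (fun i _ => hK i)
      _ = h ^ (n + 1) := by simp
  · rw [variation_congr K.toBVSet.coeFn_ind]
    exact ENNReal.toReal_le_of_le_ofReal (by positivity) (K.variation_indicator_le hK)

/-- A strong charge extending `Δ_f` takes the value `Δ_f(K)` on a rectangle `K`. -/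
lemma ExtendsIncrement.apply_rect {n : ℕ} {f : C0 (n + 1)} {μ : BVSet (n + 1) → ℝ}
    (h : ExtendsIncrement f μ) (K : Rect (n + 1)) : μ K.toBVSet = increment f K := by
  have := h 1 (fun _ => K) (fun i j hij => (hij (Subsingleton.elim i j)).elim) K.toBVSet
    (Set.iUnion_const K.toSet).symm
  simpa using this

end Rectangles

/-! ### The regular grid -/

section Grid

variable {d : ℕ}

/-- The cube `∏ [k_i / N, (k_i + 1) / N]` of the regular grid with mesh `1 / N`. -/
def cell (N : ℕ) (k : Fin d → Fin N) : Rect d where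
  a i := ⟨(k i : ℝ) / N, by positivity, div_le_one_of_le₀ (by exact_mod_cast (k i).2.le)
    (by positivity)⟩
  b i := ⟨((k i : ℝ) + 1) / N, by positivity, div_le_one_of_le₀ (by exact_mod_cast (k i).2)
    (by positivity)⟩
  lt i := by
    have : (0 : ℝ) < N := by exact_mod_cast (k i).pos
    refine Subtype.mk_lt_mk.2 ?_
    gcongr
    linarith

lemma cell_a (N : ℕ) (k : Fin d → Fin N) (i : Fin d) : ((cell N k).a i : ℝ) = (k i : ℝ) / N := rfl

lemma cell_b (N : ℕ) (k : Fin d → Fin N) (i : Fin d) :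
    ((cell N k).b i : ℝ) = ((k i : ℝ) + 1) / N := rfl

lemma cell_side (N : ℕ) (k : Fin d → Fin N) (i : Fin d) :
    ((cell N k).b i : ℝ) - (cell N k).a i = (N : ℝ)⁻¹ := by
  rw [cell_a, cell_b, ← sub_div, add_sub_cancel_left, one_div]

/-- In a coordinate where the indices differ, the two intervals share at most an endpoint. -/
lemma volume_cell_inter {N : ℕ} {k l : Fin d → Fin N} (hkl : k ≠ l) :
    volume ((cell N k).toSet ∩ (cell N l).toSet) = 0 := by
  wlog h : ∃ i, k i < l i generalizing k l
  · obtain ⟨i, hi⟩ := Function.ne_iff.1 hkl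
    rw [Set.inter_comm]
    refine this hkl.symm ⟨i, lt_of_le_of_ne ?_ hi.symm⟩
    exact not_lt.1 fun hlt => h ⟨i, hlt⟩
  obtain ⟨i, hi⟩ := h
  rw [Rect.toSet_eq_preimage, Rect.toSet_eq_preimage, ← Set.preimage_inter, Set.Icc_inter_Icc,
    (PiLp.volume_preserving_ofLp (Fin d)).measure_preimage measurableSet_Icc.nullMeasurableSet,
    Real.volume_Icc_pi]
  refine Finset.prod_eq_zero (Finset.mem_univ i) (ENNReal.ofReal_of_nonpos ?_)
  refine sub_nonpos.2 ((inf_le_left : _ ≤ ((cell N k).b i : ℝ)).trans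
    (le_trans ?_ (le_sup_right : ((cell N l).a i : ℝ) ≤ _)))
  rw [cell_a, cell_b]
  gcongr
  exact_mod_cast hi

lemma sum_integral_cell_le {N : ℕ} {g : Eucl d → ℝ} (hg : IntegrableOn g (cube d)) :
    ∑ k : Fin d → Fin N, ∫ x in (cell N k).toSet, |g x| ≤ ∫ x in cube d, |g x| := by
  have hsub : (⋃ k : Fin d → Fin N, (cell N k).toSet) ⊆ cube d :=
    Set.iUnion_subset fun k => (cell N k).toSet_subset_cube
  rw [← tsum_fintype (L := .unconditional _), ← integral_iUnion_ae
    (fun k => (cell N k).measurableSet_toSet.nullMeasurableSet)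
    (fun k l hkl => volume_cell_inter hkl) (IntegrableOn.mono_set hg.abs hsub)]
  exact setIntegral_mono_set hg.abs (.of_forall fun x => abs_nonneg _) hsub.eventuallyLE

/-- The increments of a strongly chargeable function over the cells of the grid with mesh `1 / N`
sum up in absolute value to `o(N)`. -/
lemma StronglyChargeable.sum_abs_increment_le {n : ℕ} {f : C0 (n + 1)} (hf : StronglyChargeable f)
    {ε : ℝ} (hε : 0 < ε) : ∃ C : ℝ, ∀ N : ℕ,
      ∑ k : Fin (n + 1) → Fin N, |increment f (cell N k)| ≤ ε * N + C := by
  obtain ⟨μ, ⟨α, hα, hμα⟩, hμ⟩ := hf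
  -- Chosen so that `1 + 2 * (n + 1) * N ≤ c * N` for `N ≥ 1`.
  set c : ℝ := 2 * (n + 1) + 1 with hc
  have hc0 : 0 < c := by positivity
  obtain ⟨β, ⟨g, hg, hβ⟩, hαβ⟩ := Metric.mem_closure_iff.1 hα (ε / c) (by positivity)
  -- From here on only the integrability of `g` matters: its `L¹` norm serves as the constant `C`.
  have hgi : IntegrableOn g (cube (n + 1)) := by
    have : IsFiniteMeasure (volume.restrict (cube (n + 1))) :=
      isFiniteMeasure_restrict.2 (volume_cube_lt_top _).ne
    exact hg.integrable (by exact_mod_cast Nat.succ_pos n)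
  refine ⟨∫ x in cube (n + 1), |g x|, fun N => ?_⟩
  rcases Nat.eq_zero_or_pos N with rfl | hN
  · simpa using integral_nonneg fun x => abs_nonneg (g x)
  have hN' : (0 : ℝ) < N := by exact_mod_cast hN
  have hN1 : (1 : ℝ) ≤ N := by exact_mod_cast hN
  have hcell : ∀ k : Fin (n + 1) → Fin N, |increment f (cell N k)| ≤
      ε / c * ((N : ℝ)⁻¹ ^ (n + 1) + 2 * (n + 1) * (N : ℝ)⁻¹ ^ n) +
        ∫ x in (cell N k).toSet, |g x| := by
    intro k
    have h1 : increment f (cell N k) = α (cell N k).toBVSet.ind := by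
      rw [← hμα, hμ.apply_rect]
    have h2 : |(α - β) (cell N k).toBVSet.ind| ≤
        ε / c * ((N : ℝ)⁻¹ ^ (n + 1) + 2 * (n + 1) * (N : ℝ)⁻¹ ^ n) := by
      refine ((α - β).le_opNorm _).trans ?_
      gcongr
      · rw [← dist_eq_norm]; exact hαβ.le
      · exact (cell N k).norm_ind_le fun i => (cell_side N k i).le
    have h3 : |β (cell N k).toBVSet.ind| ≤ ∫ x in (cell N k).toSet, |g x| := by
      have h4 : β (cell N k).toBVSet.ind = ∫ x in (cell N k).toSet, g x := by
        rw [hβ, ← integral_indicator (cell N k).measurableSet_toSet,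
          ← setIntegral_eq_integral_of_forall_compl_eq_zero (s := cube (n + 1))
            (fun x hx => Set.indicator_of_notMem
              (fun hx' => hx ((cell N k).toSet_subset_cube hx')) _)]
        refine integral_congr_ae (ae_restrict_of_ae ?_)
        filter_upwards [(cell N k).toBVSet.coeFn_ind] with x hx
        rw [hx]
        by_cases hx' : x ∈ (cell N k).toSet <;> simp [hx', Rect.toBVSet]
      rw [h4]
      exact abs_integral_le_integral_abs
    rw [h1, show α (cell N k).toBVSet.ind = (α - β) (cell N k).toBVSet.ind +
      β (cell N k).toBVSet.ind by simp]
    exact (abs_add_le _ _).trans (add_le_add h2 h3)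
  calc ∑ k : Fin (n + 1) → Fin N, |increment f (cell N k)|
      ≤ ∑ k : Fin (n + 1) → Fin N,
        (ε / c * ((N : ℝ)⁻¹ ^ (n + 1) + 2 * (n + 1) * (N : ℝ)⁻¹ ^ n) +
          ∫ x in (cell N k).toSet, |g x|) := Finset.sum_le_sum fun k _ => hcell k
    _ = ε / c * (1 + 2 * (n + 1) * N) +
          ∑ k : Fin (n + 1) → Fin N, ∫ x in (cell N k).toSet, |g x| := by
        rw [Finset.sum_add_distrib]
        congr 1
        simp only [Finset.sum_const, Finset.card_univ, Fintype.card_pi, Fintype.card_fin,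
          Finset.prod_const, nsmul_eq_mul, Nat.cast_pow]
        rw [pow_succ (N : ℝ), inv_pow, inv_pow]
        field_simp
        ring
    _ ≤ ε / c * (c * N) + ∫ x in cube (n + 1), |g x| := by
        refine add_le_add ?_ (sum_integral_cell_le hgi)
        gcongr
        rw [hc]
        linarith
    _ = ε * N + ∫ x in cube (n + 1), |g x| := by field_simp

end Grid

/-! ### Increments of the Brownian sheet -/

section Sheet

/-- Expansion of a product of differences. It factors the alternating vertex sums of the product
covariance coordinate by coordinate. -/
lemma sum_neg_one_pow_card_mul_prod {d : ℕ} (x y : Fin d → ℝ) :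
    ∑ s : Finset (Fin d), (-1 : ℝ) ^ s.card * ∏ i, (if i ∈ s then x i else y i) =
      ∏ i, (y i - x i) := by
  rw [Finset.prod_sub, Finset.powerset_univ]
  refine Finset.sum_congr rfl fun s _ => ?_
  rw [Finset.prod_ite, mul_assoc, mul_comm (∏ i ∈ Finset.univ \ s, y i)]
  congr 3 <;> ext i <;> simp

variable {Ω : Type*} [MeasurableSpace Ω] {P : Measure Ω} {d : ℕ} {W : Ω → C0 d}

/-- Each increment is a fixed linear combination of finitely many values of `W`. Joint Gaussianity
is what later turns zero covariance into independence. -/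
lemma IsBrownianSheet.isGaussianProcess_increment (hW : IsBrownianSheet W P) :
    IsGaussianProcess (fun (K : Rect d) ω => increment (W ω) K) P := by
  classical
  refine hW.isGaussianProcess.of_isGaussianProcess fun K => ?_
  let c : Finset (Fin d) → Fin d → unitInterval := fun s i => if i ∈ s then K.a i else K.b i
  have hc : ∀ s, c s ∈ Finset.univ.image c := fun s => Finset.mem_image_of_mem c (Finset.mem_univ s)
  refine ⟨Finset.univ.image c, ∑ s : Finset (Fin d), ((-1 : ℝ) ^ s.card) •
    ContinuousLinearMap.proj (R := ℝ) (φ := fun _ => ℝ) ⟨c s, hc s⟩, fun ω => ?_⟩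
  simp [increment, c]

lemma IsBrownianSheet.memLp_two (hW : IsBrownianSheet W P) (t : Fin d → unitInterval) :
    MemLp (fun ω => W ω t) 2 P :=
  (hW.isGaussianProcess.hasGaussianLaw_eval t).memLp_two

lemma IsBrownianSheet.memLp_two_increment (hW : IsBrownianSheet W P) (K : Rect d) :
    MemLp (fun ω => increment (W ω) K) 2 P :=
  (hW.isGaussianProcess_increment.hasGaussianLaw_eval K).memLp_two

lemma IsBrownianSheet.memLp_two_abs_increment (hW : IsBrownianSheet W P) (K : Rect d) :
    MemLp (fun ω => |increment (W ω) K|) 2 P :=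
  (hW.memLp_two_increment K).abs

lemma IsBrownianSheet.integral_increment (hW : IsBrownianSheet W P) (K : Rect d) :
    ∫ ω, increment (W ω) K ∂P = 0 := by
  simp only [increment]
  rw [integral_finsetSum _ fun s _ =>
    ((hW.isGaussianProcess.hasGaussianLaw_eval _).integrable.const_mul _)]
  simp [integral_const_mul, hW.centered]

/-- The first absolute moment of the standard Gaussian law. -/
def gaussianAbsMoment : ℝ := ∫ x, |x| ∂(gaussianReal 0 1)

/-- Otherwise the identity would vanish almost everywhere and have variance `0` instead of `1`. -/
lemma gaussianAbsMoment_pos : 0 < gaussianAbsMoment := by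
  refine (integral_nonneg fun x => abs_nonneg x).lt_of_ne' fun h => ?_
  have hint : Integrable (fun x : ℝ => |x|) (gaussianReal 0 1) :=
    ((memLp_id_gaussianReal 1).integrable (by simp)).abs
  have h0 := (integral_eq_zero_iff_of_nonneg (fun x => abs_nonneg x) hint).1 h
  have hid : (fun x : ℝ => x) =ᵐ[gaussianReal 0 1] 0 := by
    filter_upwards [h0] with x hx using abs_eq_zero.1 hx
  have hv := variance_fun_id_gaussianReal (μ := 0) (v := 1)
  rw [variance_congr hid, variance_zero] at hv
  simp at hv

/-- By scaling: the law of `X` is that of a standard Gaussian times its standard deviation, also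
when this is `0`. -/
lemma integral_abs_of_hasGaussianLaw {X : Ω → ℝ} (hX : HasGaussianLaw X P)
    (h0 : ∫ ω, X ω ∂P = 0) :
    ∫ ω, |X ω| ∂P = √(Var[X; P]) * gaussianAbsMoment := by
  have hv := variance_nonneg X P
  have hmap : P.map X = (gaussianReal 0 1).map (√(Var[X; P]) * ·) := by
    rw [hX.map_eq_gaussianReal, gaussianReal_map_const_mul, h0, mul_zero, mul_one]
    congr 1
    ext
    simp [Real.sq_sqrt hv, hv]
  calc ∫ ω, |X ω| ∂P = ∫ x, |x| ∂(P.map X) :=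
        (integral_map hX.aemeasurable (by fun_prop)).symm
    _ = ∫ x, |√(Var[X; P]) * x| ∂(gaussianReal 0 1) := by
        rw [hmap, integral_map (by fun_prop) (by fun_prop)]
    _ = √(Var[X; P]) * gaussianAbsMoment := by
        simp_rw [abs_mul, abs_of_nonneg (Real.sqrt_nonneg _)]
        rw [integral_const_mul, gaussianAbsMoment]

/-! ### Independence of the cell increments and concentration of the grid sum -/

variable [IsProbabilityMeasure P]

lemma IsBrownianSheet.covariance_eval (hW : IsBrownianSheet W P) (s t : Fin d → unitInterval) :
    cov[fun ω => W ω s, fun ω => W ω t; P] = ∏ i, min (s i : ℝ) (t i : ℝ) := by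
  rw [covariance_eq_sub (hW.memLp_two s) (hW.memLp_two t), hW.centered, zero_mul, sub_zero,
    ← hW.covariance s t]
  rfl

/-- Bilinearity, expanding one argument at a time. Each factor is the length of the overlap of the
`i`-th sides, so the product is the volume of the intersection of `K` and `L`. -/
lemma IsBrownianSheet.covariance_increment (hW : IsBrownianSheet W P) (K L : Rect d) :
    cov[fun ω => increment (W ω) K, fun ω => increment (W ω) L; P] =
      ∏ i, ((min (K.b i : ℝ) (L.b i) - min (K.b i : ℝ) (L.a i)) -
        (min (K.a i : ℝ) (L.b i) - min (K.a i : ℝ) (L.a i))) := by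
  have hL : ∀ t : Fin d → unitInterval,
      cov[fun ω => W ω t, fun ω => increment (W ω) L; P] =
        ∏ i, (min (t i : ℝ) (L.b i) - min (t i : ℝ) (L.a i)) := by
    intro t
    simp only [increment]
    rw [covariance_fun_sum_right (fun s => (hW.memLp_two _).const_mul _) (hW.memLp_two t),
      ← sum_neg_one_pow_card_mul_prod]
    refine Finset.sum_congr rfl fun s _ => ?_
    rw [covariance_const_mul_right, hW.covariance_eval]
    congr 2 with i
    split_ifs <;> rfl
  have hK : (fun ω => increment (W ω) K) = fun ω => ∑ s : Finset (Fin d), (-1 : ℝ) ^ s.card *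
      W ω (fun i => if i ∈ s then K.a i else K.b i) := rfl
  rw [hK, covariance_fun_sum_left (fun s => (hW.memLp_two _).const_mul _) (hW.memLp_two_increment L),
    ← sum_neg_one_pow_card_mul_prod]
  refine Finset.sum_congr rfl fun s _ => ?_
  rw [covariance_const_mul_left, hL]
  congr 2 with i
  split_ifs <;> rfl

lemma IsBrownianSheet.variance_increment_cell (hW : IsBrownianSheet W P) {N : ℕ}
    (k : Fin d → Fin N) : Var[fun ω => increment (W ω) (cell N k); P] = (N : ℝ)⁻¹ ^ d := by
  rw [← covariance_self (hW.memLp_two_increment _).aemeasurable, hW.covariance_increment]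
  refine (Finset.prod_congr rfl fun i _ => ?_).trans (Fin.prod_const d (N : ℝ)⁻¹)
  have hi : ((cell N k).a i : ℝ) ≤ (cell N k).b i := ((cell N k).lt i).le
  rw [min_self, min_self, min_eq_right hi, min_eq_left hi, sub_self, sub_zero, cell_side]

lemma IsBrownianSheet.covariance_increment_cell (hW : IsBrownianSheet W P) {N : ℕ}
    {k l : Fin d → Fin N} (hkl : k ≠ l) :
    cov[fun ω => increment (W ω) (cell N k), fun ω => increment (W ω) (cell N l); P] = 0 := by
  wlog h : ∃ i, k i < l i generalizing k l
  · obtain ⟨i, hi⟩ := Function.ne_iff.1 hkl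
    rw [covariance_comm]
    refine this hkl.symm ⟨i, lt_of_le_of_ne ?_ hi.symm⟩
    exact not_lt.1 fun hlt => h ⟨i, hlt⟩
  obtain ⟨i, hi⟩ := h
  rw [hW.covariance_increment]
  refine Finset.prod_eq_zero (Finset.mem_univ i) ?_
  have h1 : ((cell N k).b i : ℝ) ≤ (cell N l).a i := by
    rw [cell_a, cell_b]
    gcongr
    exact_mod_cast hi
  have h2 : ((cell N k).a i : ℝ) ≤ (cell N k).b i := ((cell N k).lt i).le
  have h3 : ((cell N l).a i : ℝ) ≤ (cell N l).b i := ((cell N l).lt i).le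
  rw [min_eq_left (h1.trans h3), min_eq_left h1, min_eq_left (h2.trans (h1.trans h3)),
    min_eq_left (h2.trans h1)]
  simp

lemma IsBrownianSheet.indepFun_increment_cell (hW : IsBrownianSheet W P) {N : ℕ}
    {k l : Fin d → Fin N} (hkl : k ≠ l) :
    IndepFun (fun ω => increment (W ω) (cell N k)) (fun ω => increment (W ω) (cell N l)) P :=
  hW.isGaussianProcess_increment.hasGaussianLaw_prodMk.indepFun_of_covariance_eq_zero
    (hW.covariance_increment_cell hkl)

lemma IsBrownianSheet.integral_sum_abs_increment (hW : IsBrownianSheet W P) (N : ℕ) :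
    ∫ ω, (∑ k : Fin d → Fin N, |increment (W ω) (cell N k)|) ∂P =
      √((N : ℝ) ^ d) * gaussianAbsMoment := by
  rw [integral_finsetSum _ fun k _ => (hW.memLp_two_abs_increment _).integrable (by norm_num)]
  have h : ∀ k : Fin d → Fin N, ∫ ω, |increment (W ω) (cell N k)| ∂P =
      √((N : ℝ)⁻¹ ^ d) * gaussianAbsMoment := fun k => by
    rw [integral_abs_of_hasGaussianLaw (hW.isGaussianProcess_increment.hasGaussianLaw_eval _)
      (hW.integral_increment _), hW.variance_increment_cell]
  simp only [h, Finset.sum_const, Finset.card_univ, Fintype.card_pi, Fintype.card_fin,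
    Finset.prod_const, nsmul_eq_mul, Nat.cast_pow]
  rw [← mul_assoc, inv_pow, Real.sqrt_inv, ← div_eq_mul_inv, Real.div_sqrt]

/-- By independence the variances add: `N ^ d` terms, each at most the second moment `N ^ (-d)`. -/
lemma IsBrownianSheet.variance_sum_abs_increment_le (hW : IsBrownianSheet W P) {N : ℕ}
    (hN : 0 < N) :
    Var[fun ω => ∑ k : Fin d → Fin N, |increment (W ω) (cell N k)|; P] ≤ 1 := by
  have hN' : (0 : ℝ) < N := by exact_mod_cast hN
  have hfun : (fun ω => ∑ k : Fin d → Fin N, |increment (W ω) (cell N k)|) =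
      ∑ k : Fin d → Fin N, fun ω => |increment (W ω) (cell N k)| := by
    ext ω; simp
  rw [hfun, IndepFun.variance_sum (fun k _ => hW.memLp_two_abs_increment _)
    (fun k _ l _ hkl => (hW.indepFun_increment_cell hkl).comp measurable_abs measurable_abs)]
  calc ∑ k : Fin d → Fin N, Var[fun ω => |increment (W ω) (cell N k)|; P]
      ≤ ∑ _k : Fin d → Fin N, (N : ℝ)⁻¹ ^ d := by
        refine Finset.sum_le_sum fun k _ => ?_
        refine (variance_le_expectation_sq
          (hW.memLp_two_abs_increment _).aestronglyMeasurable).trans_eq ?_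
        rw [← hW.variance_increment_cell k, variance_of_integral_eq_zero
          (hW.memLp_two_increment _).aemeasurable (hW.integral_increment _)]
        simp
    _ = 1 := by
        simp only [Finset.sum_const, Finset.card_univ, Fintype.card_pi, Fintype.card_fin,
          Finset.prod_const, nsmul_eq_mul, Nat.cast_pow]
        rw [inv_pow]
        field_simp

/-- Almost surely, the increments of the Brownian sheet over the cells of the grid with mesh `1 / N`
sum up in absolute value to at least a constant times `N`. -/
lemma IsBrownianSheet.eventually_le_sum_abs_increment (hW : IsBrownianSheet W P) (hd : 2 ≤ d) :
    ∀ᵐ ω ∂P, ∀ᶠ n : ℕ in Filter.atTop, gaussianAbsMoment / 2 * ((n + 1 : ℕ) : ℝ) <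
      ∑ k : Fin d → Fin (n + 1), |increment (W ω) (cell (n + 1) k)| := by
  set c := gaussianAbsMoment with hc
  have hc0 : 0 < c := gaussianAbsMoment_pos
  let A : ℕ → Set Ω := fun n =>
    {ω | ∑ k : Fin d → Fin (n + 1), |increment (W ω) (cell (n + 1) k)| ≤
      c / 2 * ((n + 1 : ℕ) : ℝ)}
  have hA : ∀ n, P (A n) ≤ ENNReal.ofReal (4 / c ^ 2 * (1 / ((n + 1 : ℕ) : ℝ) ^ 2)) := by
    intro n
    set N : ℕ := n + 1 with hN
    have hN0 : 0 < N := Nat.succ_pos n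
    have hN1 : (1 : ℝ) ≤ N := by exact_mod_cast hN0
    -- Here `d ≥ 2` makes the mean of the sum at least `c * N`.
    have hsqrt : (N : ℝ) ≤ √((N : ℝ) ^ d) :=
      Real.le_sqrt_of_sq_le (pow_le_pow_right₀ hN1 hd)
    -- On `A n` the sum falls below its mean by at least `c / 2 * N`; with variance at most `1` this
    -- has probability `O(1 / N ^ 2)`, which is summable.
    have hcheb := meas_ge_le_variance_div_sq
      (X := fun ω => ∑ k : Fin d → Fin N, |increment (W ω) (cell N k)|) (μ := P)
      (memLp_finsetSum _ fun k _ => hW.memLp_two_abs_increment _) (c := c / 2 * N) (by positivity)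
    refine (measure_mono fun ω hω => ?_).trans (hcheb.trans (ENNReal.ofReal_le_ofReal ?_))
    · have hω' : ∑ k : Fin d → Fin N, |increment (W ω) (cell N k)| ≤ c / 2 * N := hω
      change c / 2 * N ≤ |_ - _|
      rw [hW.integral_sum_abs_increment N, abs_sub_comm]
      refine le_trans ?_ (le_abs_self _)
      have := mul_le_mul_of_nonneg_right hsqrt hc0.le
      rw [← hc]
      linarith
    · calc _ ≤ 1 / (c / 2 * N) ^ 2 := by
            gcongr
            exact hW.variance_sum_abs_increment_le hN0
        _ = 4 / c ^ 2 * (1 / (N : ℝ) ^ 2) := by field_simp; norm_num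
  have hsum : Summable fun n : ℕ => 4 / c ^ 2 * (1 / ((n + 1 : ℕ) : ℝ) ^ 2) :=
    ((summable_nat_add_iff 1).2 (Real.summable_one_div_nat_pow.2 one_lt_two)).mul_left _
  have hfin : ∑' n, P (A n) ≠ ⊤ :=
    ne_top_of_le_ne_top hsum.tsum_ofReal_ne_top (ENNReal.tsum_le_tsum hA)
  filter_upwards [ae_eventually_notMem hfin] with ω hω
  filter_upwards [hω] with n hn using not_le.1 hn

end Sheet

end BrownianSheet

end

theorem mainTheorem3 {Ω : Type*} [MeasurableSpace Ω] (P : MeasureTheory.Measure Ω)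
    [MeasureTheory.IsProbabilityMeasure P] (d : ℕ) (hd : 2 ≤ d)
    (W : Ω → BrownianSheet.C0 d) (hW : BrownianSheet.IsBrownianSheet W P) :
    ∀ᵐ ω ∂P, ¬ BrownianSheet.StronglyChargeable (W ω) := by
  have hpos := BrownianSheet.gaussianAbsMoment_pos
  filter_upwards [hW.eventually_le_sum_abs_increment hd] with ω hω hch
  obtain ⟨m, rfl⟩ : ∃ m, d = m + 1 := ⟨d - 1, by omega⟩
  -- Half the almost sure lower rate `gaussianAbsMoment / 2`: the bounds clash once the remaining
  -- quarter, times `n + 1`, exceeds `C`.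
  obtain ⟨C, hC⟩ := hch.sum_abs_increment_le (ε := BrownianSheet.gaussianAbsMoment / 4)
    (by positivity)
  obtain ⟨M, hM⟩ := exists_nat_gt (C / (BrownianSheet.gaussianAbsMoment / 4))
  obtain ⟨n, hn, hMn⟩ := (hω.and (Filter.eventually_ge_atTop M)).exists
  have h1 := hC (n + 1)
  have h2 : C < BrownianSheet.gaussianAbsMoment / 4 * ((n + 1 : ℕ) : ℝ) := by
    rw [div_lt_iff₀ (by positivity)] at hM
    refine hM.trans_le ?_
    rw [mul_comm]
    gcongr
    omega
  linarith
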